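/- Let $Q=(Q(i,j))_{i,j\in E}$ be a totally stable and regular generator on a countable set $E$: all entries are finite, $Q(i,j)\ge 0$ for $i\neq j$, every row sums to $0$, and the minimal transition function of $Q$ is honest (no explosion). Let the continuous-time Markov chain with generator $Q$ be irreducible and positive recurrent, with invariant probability vector $\boldsymbol\pi$. Let $A$ be a finite non-empty subset of $E$ and $B=E\setminus A$, and partition $Q$ into the blocks $Q_{AA},Q_{AB},Q_{BA},Q_{BB}$. Put $$\widehat Q_{BB}=\int_0^\infty \exp(Q_{BB}t)\,dt,\qquad Q^{(A)}=Q_{AA}+Q_{AB}\widehat Q_{BB}Q_{BA},$$ where $\exp(Q_{BB}t)$ denotes the minimal nonnegative solution $P(t)$, $t\ge0$, of the backward equation $P'(t)=Q_{BB}P(t)$, $P(0)=I$. Let $\boldsymbol e$ be the column vector of ones, and for a finite square matrix $W$ let $W^{\#}$ be its group inverse, i.e. the unique matrix with $WW^{\#}W=W$, $W^{\#}WW^{\#}=W^{\#}$ and $W^{\#}W=WW^{\#}$. Then the matrices $\widehat Q_{BB}$, $\widehat Q_{BB}Q_{BA}$, $Q_{AB}\widehat Q_{BB}$, $Q_{AB}\widehat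 Q_{BB}Q_{BA}$ and the vectors $\widehat Q_{BB}\boldsymbol e$, $Q_{AB}\widehat Q_{BB}\boldsymbol e$ are finite, the group inverse $(-Q^{(A)})^{\#}$ exists, and the matrix $\widetilde X$ on $E\times E$ with row blocks $$\widetilde X_A=\left(-Q^{(A)}\right)^{\#}\left(\left[I,\;Q_{AB}\widehat Q_{BB}\right]-\left(\boldsymbol e+Q_{AB}\widehat Q_{BB}\boldsymbol e\right)\boldsymbol\pi^T\right),$$ $$\widetilde X_B=\widehat Q_{BB}Q_{BA}\widetilde X_A+\left[O,\;\widehat Q_{BB}\right]-\widehat Q_{BB}\boldsymbol e\,\boldsymbol\pi^T$$ is a solution of Poisson's equation $$-QX=I-\boldsymbol e\boldsymbol\pi^T ,$$ where every entry of $Q\widetilde X$ is an absolutely convergent series. -/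

import Mathlib

open scoped ENNReal Topology
open MeasureTheory Filter

noncomputable section

namespace CTMC

/-- Picard iterates of the backward integral equation
`p t i j = δ i j * exp (M i i t) + ∫₀ᵗ exp (M i i s) ∑_{k ≠ i} M i k * p (t - s) k j ds`
attached to a matrix `M` with nonnegative off-diagonal entries, started from `0`. -/
def backwardIter {S : Type*} [DecidableEq S] (M : Matrix S S ℝ) : ℕ → ℝ → S → S → ℝ≥0∞
  | 0, _, _, _ => 0
  | n + 1, t, i, j =>
      (if i = j then ENNReal.ofReal (Real.exp (M i i * t)) else 0) +
        ∫⁻ s in Set.Ioc 0 t, ENNReal.ofReal (Real.exp (M i i * s)) *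
          ∑' k, (if k = i then 0 else ENNReal.ofReal (M i k)) * backwardIter M n (t - s) k j

/-- The minimal nonnegative solution `p t i j` (`t ≥ 0`) of the backward integral equation of `M`,
that is, of `p' = M p`, `p 0 = I`: Feller's minimal transition function. This is the meaning of
`exp (M t)` for a possibly infinite, possibly unbounded `M` with nonnegative off-diagonal entries
and nonpositive row sums. -/
def minTransition {S : Type*} [DecidableEq S] (M : Matrix S S ℝ) (t : ℝ) (i j : S) : ℝ≥0∞ :=
  ⨆ n, backwardIter M n t i j

/-- `Q` is a totally stable (all entries are finite) and regular generator: it is conservative and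
its minimal transition function is honest, i.e. there is no explosion, so that `minTransition Q`
is the only transition function with generator `Q`. -/
structure IsRegularGenerator {E : Type*} [DecidableEq E] (Q : Matrix E E ℝ) : Prop where
  offDiag_nonneg : ∀ i j, i ≠ j → 0 ≤ Q i j
  row_sum : ∀ i, HasSum (fun j => Q i j) 0
  honest : ∀ t : ℝ, 0 ≤ t → ∀ i, ∑' j, minTransition Q t i j = 1

/-- Every state can be reached from every state by the chain with generator `Q`. -/
def IsIrreducible {E : Type*} [DecidableEq E] (Q : Matrix E E ℝ) : Prop :=
  ∀ i j, ∃ t : ℝ, 0 ≤ t ∧ 0 < minTransition Q t i j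

/-- Every state is recurrent (infinite expected total occupation time) and positive
(the transition probabilities back to the state do not tend to `0`). -/
def IsPositiveRecurrent {E : Type*} [DecidableEq E] (Q : Matrix E E ℝ) : Prop :=
  ∀ i, (∫⁻ t in Set.Ioi (0 : ℝ), minTransition Q t i i) = ∞ ∧
    ∃ c : ℝ≥0∞, 0 < c ∧ Tendsto (fun t : ℝ => minTransition Q t i i) atTop (𝓝 c)

/-- `π` is an invariant probability vector of the chain with generator `Q`: `πᵀ P(t) = πᵀ` for all
`t ≥ 0`, and `πᵀ e = 1`. -/
structure IsInvariantProb {E : Type*} [DecidableEq E] (Q : Matrix E E ℝ) (π : E → ℝ) : Prop where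
  nonneg : ∀ i, 0 ≤ π i
  sum_one : HasSum π 1
  invariant : ∀ t : ℝ, 0 ≤ t → ∀ j,
    ∑' i, ENNReal.ofReal (π i) * minTransition Q t i j = ENNReal.ofReal (π j)

/-- `V` is the group inverse of the finite square matrix `W`. -/
structure IsGroupInverse {m : Type*} [Fintype m] (W V : Matrix m m ℝ) : Prop where
  mul_mul_left : W * V * W = W
  mul_mul_right : V * W * V = V
  comm : V * W = W * V

theorem IsGroupInverse.unique {m : Type*} [Fintype m] {W V V' : Matrix m m ℝ}
    (h : IsGroupInverse W V) (h' : IsGroupInverse W V') : V = V' := by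
  have key : V * W = V' * W := by
    calc V * W = W * V := h.comm
      _ = (W * V' * W) * V := by rw [h'.mul_mul_left]
      _ = V' * (W * (W * V)) := by rw [← h'.comm]; simp only [Matrix.mul_assoc]
      _ = V' * (W * V * W) := by rw [← h.comm]; simp only [Matrix.mul_assoc, h.comm]
      _ = V' * W := by rw [h.mul_mul_left]
  calc V = V * W * V := h.mul_mul_right.symm
    _ = V' * W * V := by rw [key]
    _ = V' * (W * V) := by rw [Matrix.mul_assoc]
    _ = V' * (V' * W) := by rw [← h.comm, key]
    _ = V' * (W * V') := by rw [h'.comm]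
    _ = V' * W * V' := by rw [Matrix.mul_assoc]
    _ = V' := h'.mul_mul_right

open Classical in
/-- The group inverse `W^#` (the zero matrix if `W` has none). -/
def groupInverse {m : Type*} [Fintype m] (W : Matrix m m ℝ) : Matrix m m ℝ :=
  if h : ∃ V, IsGroupInverse W V then h.choose else 0

/-- Product of nonnegative, possibly infinite, matrices, with values in `[0, ∞]`. -/
def nnMul {l m n : Type*} (M : Matrix l m ℝ≥0∞) (N : Matrix m n ℝ≥0∞) : Matrix l n ℝ≥0∞ :=
  fun i j => ∑' k, M i k * N k j

/-- Row sums `M e` of a nonnegative, possibly infinite, matrix, with values in `[0, ∞]`. -/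
def nnRowSum {l m : Type*} (M : Matrix l m ℝ≥0∞) : l → ℝ≥0∞ :=
  fun i => ∑' k, M i k

section Blocks

variable {E : Type*} [DecidableEq E] (Q : Matrix E E ℝ) (A : Finset E)

/-- The block `Q_AB`, `B` the complement of `A`, with its (nonnegative) entries in `[0, ∞]`. -/
def blockAB : Matrix {x // x ∈ A} {x // x ∉ A} ℝ≥0∞ :=
  (Q.toBlock (· ∈ A) (· ∉ A)).map ENNReal.ofReal

/-- The block `Q_BA`, with its (nonnegative) entries in `[0, ∞]`. -/
def blockBA : Matrix {x // x ∉ A} {x // x ∈ A} ℝ≥0∞ :=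
  (Q.toBlock (· ∉ A) (· ∈ A)).map ENNReal.ofReal

/-- `Q̂_BB = ∫₀^∞ exp (Q_BB t) dt`. -/
def hatQ : Matrix {x // x ∉ A} {x // x ∉ A} ℝ≥0∞ :=
  fun i j => ∫⁻ t in Set.Ioi (0 : ℝ), minTransition (Q.toBlock (· ∉ A) (· ∉ A)) t i j

/-- `Q_AB Q̂_BB`. -/
def ABhat : Matrix {x // x ∈ A} {x // x ∉ A} ℝ≥0∞ := nnMul (blockAB Q A) (hatQ Q A)

/-- `Q̂_BB Q_BA`. -/
def hatBA : Matrix {x // x ∉ A} {x // x ∈ A} ℝ≥0∞ := nnMul (hatQ Q A) (blockBA Q A)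

/-- `Q_AB Q̂_BB Q_BA`. -/
def ABhatBA : Matrix {x // x ∈ A} {x // x ∈ A} ℝ≥0∞ := nnMul (ABhat Q A) (blockBA Q A)

/-- The censored generator `Q^(A) = Q_AA + Q_AB Q̂_BB Q_BA`. -/
def censored : Matrix {x // x ∈ A} {x // x ∈ A} ℝ :=
  Q.toBlock (· ∈ A) (· ∈ A) + (ABhatBA Q A).map ENNReal.toReal

/-- All the nonnegative integrals and series that enter the construction of the solution
converge to finite values. -/
structure WellDefined : Prop where
  hatQ_finite : ∀ i j, hatQ Q A i j ≠ ∞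
  hatQ_row_finite : ∀ i, nnRowSum (hatQ Q A) i ≠ ∞
  ABhat_finite : ∀ i j, ABhat Q A i j ≠ ∞
  ABhat_row_finite : ∀ i, nnRowSum (ABhat Q A) i ≠ ∞
  hatBA_finite : ∀ i j, hatBA Q A i j ≠ ∞
  ABhatBA_finite : ∀ i j, ABhatBA Q A i j ≠ ∞

/-- The `A × E` matrix `[I, Q_AB Q̂_BB] - (e + Q_AB Q̂_BB e) πᵀ`. -/
def rhsA (π : E → ℝ) : Matrix {x // x ∈ A} E ℝ := fun i n =>
  (if hn : n ∈ A then (1 : Matrix {x // x ∈ A} {x // x ∈ A} ℝ) i ⟨n, hn⟩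
    else (ABhat Q A i ⟨n, hn⟩).toReal)
  - (1 + (nnRowSum (ABhat Q A) i).toReal) * π n

/-- The rows in `A`: `X_A = (-Q^(A))^# ([I, Q_AB Q̂_BB] - (e + Q_AB Q̂_BB e) πᵀ)`. -/
def solA (π : E → ℝ) : Matrix {x // x ∈ A} E ℝ :=
  groupInverse (-censored Q A) * rhsA Q A π

/-- The rows in `B`: `X_B = Q̂_BB Q_BA X_A + [O, Q̂_BB] - Q̂_BB e πᵀ`. -/
def solB (π : E → ℝ) : Matrix {x // x ∉ A} E ℝ := fun i n =>
  ((hatBA Q A).map ENNReal.toReal * solA Q A π) i n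
  + (if hn : n ∈ A then 0 else (hatQ Q A i ⟨n, hn⟩).toReal)
  - (nnRowSum (hatQ Q A) i).toReal * π n

/-- The matrix with row blocks `X_A` and `X_B`. -/
def sol (π : E → ℝ) : Matrix E E ℝ := fun i n =>
  if hi : i ∈ A then solA Q A π ⟨i, hi⟩ n else solB Q A π ⟨i, hi⟩ n

end Blocks

end CTMC

end

namespace CTMC

/-! ### Minimal solutions of `G = D (I + N G)` over `[0, ∞]`. -/

section Green

/-! Split Poisson's equation along `A` and `B`. The kernel `Q̂_BB` satisfies `-Q_BB Q̂_BB = I`, so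
the `B` rows hold whatever `X_A` is, and substituting `X_B` into the `A` rows leaves the finite
system `-Q^(A) X_A = R`, with `R` the matrix `rhsA`. The group inverse solves it once the left
kernel of `Q^(A)` is spanned by `π_A`, the right kernel by `e`, and `π_A R = 0`.

All of this rests on the identity `π_B = π_A Q_AB Q̂_BB` (`Stationary.eq_sum_ABhat`). Minimality of
`Q̂_BB` gives `≥`. The measure equal to `π` on `A` and to the right-hand side on `B` is then
excessive; recurrence makes it stationary and irreducibility makes it `π`. As `π` has finite mass,
the identity also yields every finiteness claim.

Transition functions enter only through their Laplace transforms (`laplace_minTransition`), which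
are minimal solutions of linear equations in `[0, ∞]`, where series may be rearranged freely. Real
numbers appear once finiteness is known; there `HasSum` is absolute convergence. -/

theorem tsum_iSup_of_monotone {α : Type*} {f : ℕ → α → ℝ≥0∞} (hf : Monotone f) :
    ∑' a, ⨆ n, f n a = ⨆ n, ∑' a, f n a := by
  simp_rw [ENNReal.tsum_eq_iSup_sum]
  rw [iSup_comm]
  exact iSup_congr fun s => ENNReal.finsetSum_iSup_of_monotone fun a m n h => hf h a

variable {S : Type*} [DecidableEq S]

/-- Iterates, from `0`, of `G ↦ D (I + N G)` for a diagonal matrix `D` and a nonnegative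
matrix `N`. -/
noncomputable def greenIter (D : S → ℝ≥0∞) (N : S → S → ℝ≥0∞) : ℕ → S → S → ℝ≥0∞
  | 0, _, _ => 0
  | n + 1, i, j => D i * ((if i = j then 1 else 0) + ∑' k, N i k * greenIter D N n k j)

/-- The minimal nonnegative solution of `G = D (I + N G)`. -/
noncomputable def green (D : S → ℝ≥0∞) (N : S → S → ℝ≥0∞) : S → S → ℝ≥0∞ :=
  fun i j => ⨆ n, greenIter D N n i j

variable (D : S → ℝ≥0∞) (N : S → S → ℝ≥0∞)

theorem greenIter_mono (i j : S) : Monotone fun n => greenIter D N n i j := by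
  refine monotone_nat_of_le_succ fun n => ?_
  induction n generalizing i j with
  | zero => exact zero_le
  | succ n ih =>
    rw [greenIter, greenIter]
    gcongr with k
    exact ih k j

theorem iSup_greenIter_succ (i j : S) : ⨆ n, greenIter D N (n + 1) i j = green D N i j :=
  (greenIter_mono D N i j).iSup_nat_add 1

theorem green_backward (i j : S) :
    green D N i j = D i * ((if i = j then 1 else 0) + ∑' k, N i k * green D N k j) := by
  have h : Monotone fun (n : ℕ) (k : S) => N i k * greenIter D N n k j :=
    fun m n hmn k => mul_le_mul_right (greenIter_mono D N k j hmn) _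
  rw [← iSup_greenIter_succ]
  simp only [green, greenIter, ENNReal.mul_iSup, ENNReal.add_iSup, tsum_iSup_of_monotone h]

/-- Each iterate sums the weights `D N D ⋯ N D` of paths with a bounded number of jumps, so the last
jump can be peeled off instead of the first. -/
theorem greenIter_forward (n : ℕ) (i j : S) :
    greenIter D N (n + 1) i j =
      ((if i = j then 1 else 0) + ∑' k, greenIter D N n i k * N k j) * D j := by
  induction n generalizing i j with
  | zero =>
    simp only [greenIter, mul_zero, zero_mul, tsum_zero, add_zero]
    split_ifs with h
    · subst h; simp
    · simp
  | succ n ih =>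
    have e1 : ∑' k, N i k * greenIter D N (n + 1) k j =
        N i j * D j + ∑' k, ∑' l, N i k * greenIter D N n k l * N l j * D j := by
      rw [tsum_congr fun k => by rw [ih k j]]
      have : ∀ k, N i k * (((if k = j then 1 else 0) + ∑' l, greenIter D N n k l * N l j) * D j) =
          (if k = j then N i j * D j else 0) +
            ∑' l, N i k * greenIter D N n k l * N l j * D j := by
        intro k
        rw [ENNReal.tsum_mul_right]
        simp_rw [mul_assoc (N i k)]
        rw [ENNReal.tsum_mul_left]
        split_ifs with h
        · subst h; ring
        · ring
      rw [tsum_congr this, ENNReal.tsum_add, tsum_ite_eq]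
    have e2 : ∑' l, greenIter D N (n + 1) i l * N l j =
        D i * N i j + ∑' l, ∑' k, D i * (N i k * greenIter D N n k l * N l j) := by
      have : ∀ l, greenIter D N (n + 1) i l * N l j =
          (if l = i then D i * N i j else 0) +
            ∑' k, D i * (N i k * greenIter D N n k l * N l j) := by
        intro l
        rw [ENNReal.tsum_mul_left, ENNReal.tsum_mul_right, greenIter]
        by_cases h : l = i
        · subst h; simp; ring
        · simp [h, Ne.symm h]; ring
      rw [tsum_congr this, ENNReal.tsum_add, tsum_ite_eq]
    rw [greenIter, e1, e2, ENNReal.tsum_comm]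
    simp_rw [ENNReal.tsum_mul_right, ENNReal.tsum_mul_left, ENNReal.tsum_mul_right]
    split_ifs with h
    · subst h; ring
    · ring

theorem green_forward (i j : S) :
    green D N i j = ((if i = j then 1 else 0) + ∑' k, green D N i k * N k j) * D j := by
  have h : Monotone fun (n : ℕ) (k : S) => greenIter D N n i k * N k j :=
    fun m n hmn k => mul_le_mul_left (greenIter_mono D N i k hmn) _
  rw [← iSup_greenIter_succ]
  simp only [green, greenIter_forward, ENNReal.iSup_mul, ENNReal.add_iSup, tsum_iSup_of_monotone h]

variable {D N}

/-- Minimality on the left: a supersolution of the forward equation with source `r` dominates `r`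
times every iterate, by induction. -/
theorem tsum_mul_green_le {r x : S → ℝ≥0∞} (h : ∀ j, (r j + ∑' k, x k * N k j) * D j ≤ x j)
    (j : S) : ∑' i, r i * green D N i j ≤ x j := by
  have hm : Monotone fun (n : ℕ) (i : S) => r i * greenIter D N n i j :=
    fun m n hmn i => mul_le_mul_right (greenIter_mono D N i j hmn) _
  simp only [green, ENNReal.mul_iSup, tsum_iSup_of_monotone hm]
  refine iSup_le fun n => ?_
  clear hm
  induction n generalizing j with
  | zero => simp [greenIter]
  | succ n ih =>
    refine le_trans ?_ (h j)
    have : ∀ i, r i * greenIter D N (n + 1) i j =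
        (if i = j then r j * D j else 0) + ∑' k, r i * greenIter D N n i k * N k j * D j := by
      intro i
      rw [greenIter_forward]
      simp_rw [ENNReal.tsum_mul_right, mul_assoc (r i)]
      rw [ENNReal.tsum_mul_left]
      split_ifs with h
      · subst h; ring
      · ring
    rw [tsum_congr this, ENNReal.tsum_add, tsum_ite_eq, ENNReal.tsum_comm, add_mul,
      ← ENNReal.tsum_mul_right]
    refine add_le_add le_rfl (ENNReal.tsum_le_tsum fun k => ?_)
    simp_rw [ENNReal.tsum_mul_right]
    gcongr
    exact ih k

theorem tsum_green_mul_le {c x : S → ℝ≥0∞} (h : ∀ i, D i * (c i + ∑' k, N i k * x k) ≤ x i)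
    (i : S) : ∑' j, green D N i j * c j ≤ x i := by
  have hm : Monotone fun (n : ℕ) (j : S) => greenIter D N n i j * c j :=
    fun m n hmn j => mul_le_mul_left (greenIter_mono D N i j hmn) _
  simp only [green, ENNReal.iSup_mul, tsum_iSup_of_monotone hm]
  refine iSup_le fun n => ?_
  clear hm
  induction n generalizing i with
  | zero => simp [greenIter]
  | succ n ih =>
    refine le_trans ?_ (h i)
    have : ∀ j, greenIter D N (n + 1) i j * c j =
        D i * ((if j = i then c i else 0) + ∑' k, N i k * (greenIter D N n k j * c j)) := by
      intro j
      simp_rw [greenIter, ← mul_assoc, ENNReal.tsum_mul_right]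
      by_cases h : j = i
      · subst h; simp; ring
      · simp [h, Ne.symm h]; ring
    rw [tsum_congr this, ENNReal.tsum_mul_left, ENNReal.tsum_add, tsum_ite_eq, ENNReal.tsum_comm]
    simp_rw [ENNReal.tsum_mul_left]
    gcongr with k
    exact ih k

theorem tsum_green_mul (c : S → ℝ≥0∞) (i : S) :
    ∑' j, green D N i j * c j = D i * (c i + ∑' k, N i k * ∑' j, green D N k j * c j) := by
  have : ∀ j, green D N i j * c j =
      D i * ((if j = i then c i else 0) + ∑' k, N i k * (green D N k j * c j)) := by
    intro j
    rw [green_backward]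
    simp_rw [← mul_assoc, ENNReal.tsum_mul_right]
    by_cases h : j = i
    · subst h; simp; ring
    · simp [h, Ne.symm h]; ring
  rw [tsum_congr this, ENNReal.tsum_mul_left, ENNReal.tsum_add, tsum_ite_eq, ENNReal.tsum_comm]
  simp_rw [ENNReal.tsum_mul_left]

theorem tsum_mul_green (r : S → ℝ≥0∞) (j : S) :
    ∑' i, r i * green D N i j = (r j + ∑' k, (∑' i, r i * green D N i k) * N k j) * D j := by
  have : ∀ i, r i * green D N i j =
      ((if i = j then r j else 0) + ∑' k, r i * green D N i k * N k j) * D j := by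
    intro i
    rw [green_forward]
    simp_rw [mul_assoc, ENNReal.tsum_mul_left]
    split_ifs with h
    · subst h; ring
    · ring
  rw [tsum_congr this, ENNReal.tsum_mul_right, ENNReal.tsum_add, tsum_ite_eq, ENNReal.tsum_comm]
  simp_rw [ENNReal.tsum_mul_right]

end Green
-- Laplace transforms of minimal transition functions.
section Laplace

theorem lintegral_Ioi_exp {x : ℝ} (hx : 0 ≤ x) :
    ∫⁻ t in Set.Ioi (0 : ℝ), ENNReal.ofReal (Real.exp (-x * t)) = (ENNReal.ofReal x)⁻¹ := by
  -- At `x = 0` both sides are `∞`, since `0⁻¹ = ∞` in `ℝ≥0∞`; absorbing states thus need no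
  -- separate treatment.
  rcases hx.eq_or_lt with rfl | hx
  · simp
  · rw [← ofReal_integral_eq_lintegral_ofReal (integrableOn_exp_mul_Ioi (by linarith) _)
      (ae_of_all _ fun _ => (Real.exp_pos _).le), integral_exp_mul_Ioi (by linarith)]
    simp [ENNReal.ofReal_inv_of_pos hx]

/-- Puts the integral in the form of a convolution on the whole line, to which Tonelli and
translation invariance apply. -/
theorem lintegral_Ioc_eq_lintegral_indicator (f g : ℝ → ℝ≥0∞) (t : ℝ) :
    ∫⁻ s in Set.Ioc 0 t, f s * g (t - s) =
      ∫⁻ s, (Set.Ioi 0).indicator f s * (Set.Ici 0).indicator g (t - s) := by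
  rw [← lintegral_indicator measurableSet_Ioc]
  refine lintegral_congr fun s => ?_
  by_cases h1 : 0 < s <;> by_cases h2 : s ≤ t <;> simp [h1, h2, Set.indicator]

theorem measurable_lintegral_Ioc {f g : ℝ → ℝ≥0∞} (hf : Measurable f) (hg : Measurable g) :
    Measurable fun t : ℝ => ∫⁻ s in Set.Ioc 0 t, f s * g (t - s) := by
  simp_rw [lintegral_Ioc_eq_lintegral_indicator]
  refine Measurable.lintegral_prod_right' (f := fun p : ℝ × ℝ =>
    (Set.Ioi 0).indicator f p.2 * (Set.Ici 0).indicator g (p.1 - p.2)) ?_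
  exact ((hf.indicator measurableSet_Ioi).comp measurable_snd).mul
    ((hg.indicator measurableSet_Ici).comp (measurable_fst.sub measurable_snd))

theorem lintegral_Ioi_lintegral_Ioc {f g : ℝ → ℝ≥0∞} (hf : Measurable f) (hg : Measurable g) :
    ∫⁻ t in Set.Ioi (0 : ℝ), ∫⁻ s in Set.Ioc 0 t, f s * g (t - s) =
      (∫⁻ s in Set.Ioi (0 : ℝ), f s) * ∫⁻ t in Set.Ioi (0 : ℝ), g t := by
  have h1 : ∀ t ∉ Set.Ioi (0 : ℝ), ∫⁻ s in Set.Ioc 0 t, f s * g (t - s) = 0 := by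
    intro t ht
    rw [Set.Ioc_eq_empty (by simpa using ht)]
    simp
  rw [← lintegral_indicator measurableSet_Ioi,
    Set.indicator_eq_self.2 (Function.support_subset_iff'.2 h1)]
  simp_rw [lintegral_Ioc_eq_lintegral_indicator]
  rw [lintegral_lintegral_swap]
  · have : ∀ s, ∫⁻ t, (Set.Ioi 0).indicator f s * (Set.Ici 0).indicator g (t - s) =
        (Set.Ioi 0).indicator f s * ∫⁻ t in Set.Ioi (0 : ℝ), g t := by
      intro s
      rw [lintegral_const_mul _ (by
          exact (hg.indicator measurableSet_Ici).comp (measurable_id.sub_const s)),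
        lintegral_sub_right_eq_self (fun t => (Set.Ici 0).indicator g t) s,
        lintegral_indicator measurableSet_Ici, setLIntegral_congr Ioi_ae_eq_Ici]
    simp_rw [this]
    rw [lintegral_mul_const _ (hf.indicator measurableSet_Ioi), lintegral_indicator measurableSet_Ioi]
  · exact (((hf.indicator measurableSet_Ioi).comp measurable_snd).mul
      ((hg.indicator measurableSet_Ici).comp (measurable_fst.sub measurable_snd))).aemeasurable

variable {S : Type*} [DecidableEq S]

/-- The off-diagonal part of `M`, with values in `[0, ∞]`. -/
noncomputable def offDiag (M : Matrix S S ℝ) : S → S → ℝ≥0∞ :=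
  fun i k => if k = i then 0 else ENNReal.ofReal (M i k)

variable (M : Matrix S S ℝ)

theorem offDiag_ne_top (i k : S) : offDiag M i k ≠ ∞ := by
  unfold offDiag; split_ifs <;> simp

theorem backwardIter_mono (t : ℝ) (i j : S) : Monotone fun n => backwardIter M n t i j := by
  refine monotone_nat_of_le_succ fun n => ?_
  induction n generalizing t i j with
  | zero => exact zero_le
  | succ n ih =>
    rw [backwardIter, backwardIter]
    gcongr with s k
    exact ih _ k j

variable [Countable S]

theorem measurable_backwardIter (n : ℕ) (i j : S) :
    Measurable fun t => backwardIter M n t i j := by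
  induction n generalizing i j with
  | zero => exact measurable_const
  | succ n ih =>
    simp only [backwardIter]
    refine Measurable.add ?_ ?_
    · split_ifs
      · fun_prop
      · exact measurable_const
    · exact measurable_lintegral_Ioc (f := fun s => ENNReal.ofReal (Real.exp (M i i * s)))
        (g := fun t => ∑' k, (if k = i then 0 else ENNReal.ofReal (M i k)) * backwardIter M n t k j)
        (by fun_prop) (Measurable.tsum fun k => (ih k j).const_mul _)

theorem measurable_minTransition (i j : S) : Measurable fun t => minTransition M t i j :=
  Measurable.iSup fun n => measurable_backwardIter M n i j

variable {M}

/-- The Laplace transform turns the convolution in the backward recursion into a product, and the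
holding-time factor into `1 / (a - M i i)`. -/
theorem laplace_backwardIter (hM : ∀ i, M i i ≤ 0) {a : ℝ} (ha : 0 ≤ a) (n : ℕ) (i j : S) :
    ∫⁻ t in Set.Ioi (0 : ℝ), ENNReal.ofReal (Real.exp (-a * t)) * backwardIter M n t i j =
      greenIter (fun i => (ENNReal.ofReal (a - M i i))⁻¹) (offDiag M) n i j := by
  induction n generalizing i j with
  | zero => simp [backwardIter, greenIter]
  | succ n ih =>
    have hexp : ∀ x t : ℝ, ENNReal.ofReal (Real.exp (-a * t)) * ENNReal.ofReal (Real.exp (x * t)) =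
        ENNReal.ofReal (Real.exp (-(a - x) * t)) := by
      intro x t
      rw [← ENNReal.ofReal_mul (Real.exp_pos _).le, ← Real.exp_add]
      ring_nf
    have h0 := lintegral_Ioi_exp (x := a - M i i) (by linarith [hM i])
    have hmeas : Measurable fun t => ∑' k, offDiag M i k *
        (ENNReal.ofReal (Real.exp (-a * t)) * backwardIter M n t k j) :=
      Measurable.tsum fun k => (Measurable.mul (by fun_prop)
        (measurable_backwardIter M n k j)).const_mul _
    have hsplit : ∀ t : ℝ,
        ENNReal.ofReal (Real.exp (-a * t)) * backwardIter M (n + 1) t i j =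
        (if i = j then 1 else 0) * ENNReal.ofReal (Real.exp (-(a - M i i) * t)) +
        ∫⁻ s in Set.Ioc 0 t, ENNReal.ofReal (Real.exp (-(a - M i i) * s)) *
          (fun t => ∑' k, offDiag M i k *
            (ENNReal.ofReal (Real.exp (-a * t)) * backwardIter M n t k j)) (t - s) := by
      intro t
      rw [backwardIter, mul_add, ← lintegral_const_mul' _ _ ENNReal.ofReal_ne_top]
      congr 1
      · split_ifs
        · rw [hexp, one_mul]
        · simp
      · refine lintegral_congr fun s => ?_
        have e : ENNReal.ofReal (Real.exp (-a * t)) = ENNReal.ofReal (Real.exp (-a * s)) *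
            ENNReal.ofReal (Real.exp (-a * (t - s))) := by
          rw [← ENNReal.ofReal_mul (Real.exp_pos _).le, ← Real.exp_add]
          ring_nf
        rw [← hexp, e]
        simp_rw [mul_left_comm (offDiag M i _), ENNReal.tsum_mul_left]
        simp only [offDiag]
        ring
    simp_rw [hsplit]
    rw [lintegral_add_left (by fun_prop), lintegral_const_mul _ (by fun_prop), h0,
      lintegral_Ioi_lintegral_Ioc (by fun_prop) hmeas, h0, greenIter, mul_add, lintegral_tsum]
    · congr 1
      · rw [mul_comm]
      · refine congrArg _ ?_
        refine tsum_congr fun k => ?_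
        rw [lintegral_const_mul' _ _ (offDiag_ne_top M i k), ih k j]
    · exact fun k => ((Measurable.mul (by fun_prop)
        (measurable_backwardIter M n k j)).const_mul _).aemeasurable

/-- The resolvent of the minimal transition function is the minimal nonnegative solution of
`(a - M) R = I`. -/
theorem laplace_minTransition (hM : ∀ i, M i i ≤ 0) {a : ℝ} (ha : 0 ≤ a) (i j : S) :
    ∫⁻ t in Set.Ioi (0 : ℝ), ENNReal.ofReal (Real.exp (-a * t)) * minTransition M t i j =
      green (fun i => (ENNReal.ofReal (a - M i i))⁻¹) (offDiag M) i j := by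
  simp only [minTransition, green, ENNReal.mul_iSup, ← laplace_backwardIter hM ha]
  exact lintegral_iSup
    (fun n => Measurable.mul (by fun_prop) (measurable_backwardIter M n i j))
    fun m n hmn t => mul_le_mul_right (backwardIter_mono M t i j hmn) _

theorem lintegral_minTransition (hM : ∀ i, M i i ≤ 0) (i j : S) :
    ∫⁻ t in Set.Ioi (0 : ℝ), minTransition M t i j =
      green (fun i => (ENNReal.ofReal (-M i i))⁻¹) (offDiag M) i j := by
  simpa using laplace_minTransition hM le_rfl i j

end Laplace
-- Closed sets, stationary and excessive measures.
section Chain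

variable {E : Type*} [DecidableEq E] {Q : Matrix E E ℝ}

theorem offDiag_ne (M : Matrix E E ℝ) {i k : E} (h : k ≠ i) :
    offDiag M i k = ENNReal.ofReal (M i k) := if_neg h

theorem IsRegularGenerator.hasSum_update (hQ : IsRegularGenerator Q) (i : E) :
    HasSum (Function.update (Q i) i 0) (-Q i i) := by
  simpa using (hQ.row_sum i).update i 0

theorem IsRegularGenerator.update_nonneg (hQ : IsRegularGenerator Q) (i j : E) :
    0 ≤ Function.update (Q i) i 0 j := by
  by_cases h : j = i
  · subst h; simp
  · simpa [h] using hQ.offDiag_nonneg i j (Ne.symm h)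

theorem IsRegularGenerator.diag_nonpos (hQ : IsRegularGenerator Q) (i : E) : Q i i ≤ 0 := by
  linarith [(hQ.hasSum_update i).nonneg (hQ.update_nonneg i)]

theorem IsRegularGenerator.tsum_offDiag (hQ : IsRegularGenerator Q) (i : E) :
    ∑' k, offDiag Q i k = ENNReal.ofReal (-Q i i) := by
  rw [← (hQ.hasSum_update i).tsum_eq, ENNReal.ofReal_tsum_of_nonneg (hQ.update_nonneg i)
    (hQ.hasSum_update i).summable]
  refine tsum_congr fun k => ?_
  by_cases h : k = i
  · subst h; simp [offDiag]
  · simp [offDiag, h]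

theorem backwardIter_eq_zero_of_closed {M : Matrix E E ℝ} {S : Set E}
    (hS : ∀ i ∈ S, ∀ k, offDiag M i k ≠ 0 → k ∈ S) (n : ℕ) (t : ℝ) {i j : E} (hi : i ∈ S)
    (hj : j ∉ S) : backwardIter M n t i j = 0 := by
  induction n generalizing t i with
  | zero => rfl
  | succ n ih =>
    have hij : i ≠ j := fun h => hj (h ▸ hi)
    have h0 : ∀ s k, (if k = i then 0 else ENNReal.ofReal (M i k)) *
        backwardIter M n (t - s) k j = 0 := by
      intro s k
      by_cases h : offDiag M i k = 0
      · exact mul_eq_zero.2 (Or.inl h)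
      · rw [ih _ (hS i hi k h), mul_zero]
    simp [backwardIter, hij, h0]

/-- An irreducible chain has no proper non-empty set of states closed under its jumps. -/
theorem IsIrreducible.mem_of_closed (hirr : IsIrreducible Q) {S : Set E}
    (hS : ∀ i ∈ S, ∀ k, offDiag Q i k ≠ 0 → k ∈ S) (hne : S.Nonempty) (j : E) : j ∈ S := by
  by_contra hj
  obtain ⟨i, hi⟩ := hne
  obtain ⟨t, -, ht⟩ := hirr i j
  simp [minTransition, backwardIter_eq_zero_of_closed hS _ _ hi hj] at ht

theorem IsIrreducible.diag_ne_zero (hirr : IsIrreducible Q) (hQ : IsRegularGenerator Q)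
    {i j : E} (hij : i ≠ j) : ENNReal.ofReal (-Q i i) ≠ 0 := by
  intro h
  rw [← hQ.tsum_offDiag, ENNReal.tsum_eq_zero] at h
  exact hij.symm (hirr.mem_of_closed (S := {i}) (fun a ha k hk => by
    rw [Set.mem_singleton_iff.1 ha] at hk; exact absurd (h k) hk) ⟨i, rfl⟩ j)

/-- The stationarity equations `πᵀ Q = 0` in terms of nonnegative quantities. -/
def Stationary (Q : Matrix E E ℝ) (p : E → ℝ≥0∞) : Prop :=
  ∀ j, ∑' k, p k * offDiag Q k j = p j * ENNReal.ofReal (-Q j j)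

/-- Integrating `π P(t) = π` against `e^{-t}` shows that `π` is fixed by the resolvent at `1`. The
forward equation of that resolvent is the balance equation with an extra `π j` on each side, which
is finite and cancels. -/
theorem IsInvariantProb.stationary [Countable E] {π : E → ℝ} (hπ : IsInvariantProb Q π)
    (hQ : IsRegularGenerator Q) : Stationary Q fun i => ENNReal.ofReal (π i) := by
  intro j
  set p : E → ℝ≥0∞ := fun i => ENNReal.ofReal (π i) with hp
  set D : E → ℝ≥0∞ := fun i => (ENNReal.ofReal (1 - Q i i))⁻¹ with hD
  have key : ∀ j, ∑' i, p i * green D (offDiag Q) i j = p j := by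
    intro j
    simp_rw [hD, ← laplace_minTransition hQ.diag_nonpos zero_le_one]
    have hm : ∀ i, Measurable fun t : ℝ =>
        ENNReal.ofReal (Real.exp (-1 * t)) * minTransition Q t i j :=
      fun i => Measurable.mul (by fun_prop) (measurable_minTransition Q i j)
    rw [tsum_congr fun i => (lintegral_const_mul (p i) (hm i)).symm,
      ← lintegral_tsum fun i => ((hm i).const_mul _).aemeasurable]
    have : ∀ t ∈ Set.Ioi (0 : ℝ), ∑' i, p i *
        (ENNReal.ofReal (Real.exp (-1 * t)) * minTransition Q t i j) =
        p j * ENNReal.ofReal (Real.exp (-1 * t)) := by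
      intro t ht
      simp_rw [mul_left_comm (p _), ENNReal.tsum_mul_left]
      rw [hπ.invariant t (le_of_lt ht) j, mul_comm]
    rw [setLIntegral_congr_fun measurableSet_Ioi this, lintegral_const_mul _ (by fun_prop),
      lintegral_Ioi_exp zero_le_one]
    simp
  have h := tsum_mul_green (D := D) (N := offDiag Q) p j
  simp_rw [key] at h
  have hq := hQ.diag_nonpos j
  have h0 : ENNReal.ofReal (1 - Q j j) ≠ 0 := by
    rw [ne_eq, ENNReal.ofReal_eq_zero]; linarith
  have h1 : p j * ENNReal.ofReal (1 - Q j j) = p j + ∑' k, p k * offDiag Q k j := by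
    conv_lhs => rw [h]
    rw [mul_assoc, ENNReal.inv_mul_cancel h0 ENNReal.ofReal_ne_top, mul_one]
  rw [sub_eq_add_neg, ENNReal.ofReal_add zero_le_one (by linarith), mul_add, ENNReal.ofReal_one,
    mul_one] at h1
  exact ((ENNReal.add_right_inj ENNReal.ofReal_ne_top).1 h1).symm

/-- The support of `p` is closed under jumps: mass at `i` flows into every `k` with `Q i k > 0`. -/
theorem Stationary.ne_zero (hirr : IsIrreducible Q) {p : E → ℝ≥0∞} (hst : Stationary Q p)
    (hp : ∃ i, p i ≠ 0) (j : E) : p j ≠ 0 := by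
  refine hirr.mem_of_closed (S := {j | p j ≠ 0}) (fun i hi k hk h => ?_) hp j
  have := hst k
  rw [h, zero_mul, ENNReal.tsum_eq_zero] at this
  exact (mul_ne_zero hi hk) (this i)

/-- Excessive finite measures of a recurrent chain are invariant. -/
theorem stationary_of_excessive [Countable E] (hQ : IsRegularGenerator Q)
    (hrec : ∀ i, (∫⁻ t in Set.Ioi (0 : ℝ), minTransition Q t i i) = ∞) {x : E → ℝ≥0∞}
    (hfin : ∀ i, x i ≠ ∞)
    (hx : ∀ j, ∑' k, x k * offDiag Q k j ≤ x j * ENNReal.ofReal (-Q j j)) : Stationary Q x := by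
  -- The defect `r` of invariance satisfies `r G ≤ x` for the Green kernel `G`. Recurrence makes `G
  -- j j` infinite while `x j` is finite, so `r j = 0`.
  set r : E → ℝ≥0∞ := fun j => x j * ENNReal.ofReal (-Q j j) - ∑' k, x k * offDiag Q k j
  have hr : ∀ j, r j + ∑' k, x k * offDiag Q k j = x j * ENNReal.ofReal (-Q j j) :=
    fun j => tsub_add_cancel_of_le (hx j)
  intro j
  have hle : ∑' i, r i * green (fun i => (ENNReal.ofReal (-Q i i))⁻¹) (offDiag Q) i j ≤ x j := by
    refine tsum_mul_green_le (fun j => ?_) j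
    rw [hr, mul_assoc]
    exact mul_le_of_le_one_right' (ENNReal.mul_inv_le_one _)
  have h1 := (ENNReal.le_tsum j).trans hle
  rw [← lintegral_minTransition hQ.diag_nonpos, hrec] at h1
  have h0 : r j = 0 := by
    by_contra h
    rw [ENNReal.mul_top h] at h1
    exact hfin j (top_le_iff.1 h1)
  rw [← hr, h0, zero_add]

/-- Strict inequality propagates along jumps: if `x i < p i` and `Q i k > 0`, the inflows into `k`
differ strictly, hence so do the values at `k`. One point of equality therefore excludes it
everywhere. -/
theorem Stationary.eq_of_le (hirr : IsIrreducible Q) {x p : E → ℝ≥0∞} (hx : Stationary Q x)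
    (hp : Stationary Q p) (hfin : ∀ i, p i ≠ ∞) (hle : ∀ i, x i ≤ p i) {a : E} (ha : x a = p a)
    (j : E) : x j = p j := by
  by_contra hj
  refine hirr.mem_of_closed (S := {j | x j ≠ p j}) (fun i hi k hk h => ?_) ⟨j, hj⟩ a ha
  refine absurd ((hx k).trans ((congrArg (· * _) h).trans (hp k).symm)) (ne_of_lt ?_)
  refine ENNReal.tsum_lt_tsum (i := i) ?_ (fun b => by gcongr; exact hle b) ?_
  · rw [hx k, h]
    exact ENNReal.mul_ne_top (hfin k) ENNReal.ofReal_ne_top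
  · exact ENNReal.mul_lt_mul_left hk (offDiag_ne_top Q i k) (lt_of_le_of_ne (hle i) hi)

end Chain
-- The kernel `Q̂_BB`, the identity for `π_B`, and finiteness.
section Censoring

theorem hasSum_of_blocks {E : Type*} {A : Finset E} {M : Type*} [AddCommMonoid M] [TopologicalSpace M] [ContinuousAdd M]
    {f : E → M} {b : M} (hb : HasSum (fun k : {x // x ∉ A} => f k) b) :
    HasSum f ((∑ k : {x // x ∈ A}, f k) + b) :=
  HasSum.add_compl (s := (A : Set E)) (f := f)
    (hasSum_fintype fun k : {x // x ∈ A} => f k) hb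

theorem tsum_blocks {E : Type*} (A : Finset E) (f : E → ℝ≥0∞) :
    ∑' k, f k = (∑ k : {x // x ∈ A}, f k) + ∑' k : {x // x ∉ A}, f k :=
  (hasSum_of_blocks ENNReal.summable.hasSum).tsum_eq

variable {E : Type*} [DecidableEq E] {Q : Matrix E E ℝ} {A : Finset E}

theorem offDiag_toBlock (i k : {x // x ∉ A}) :
    offDiag (Q.toBlock (· ∉ A) (· ∉ A)) i k = offDiag Q i k := by
  simp [offDiag, Subtype.ext_iff]

theorem blockAB_eq_offDiag (a : {x // x ∈ A}) (k : {x // x ∉ A}) :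
    blockAB Q A a k = offDiag Q a k :=
  (offDiag_ne Q fun h : (k : E) = a => k.2 (h ▸ a.2)).symm

theorem blockBA_eq_offDiag (k : {x // x ∉ A}) (a : {x // x ∈ A}) :
    blockBA Q A k a = offDiag Q k a :=
  (offDiag_ne Q fun h : (a : E) = k => k.2 (h ▸ a.2)).symm

theorem IsIrreducible.diag_ne_zero_of_notMem (hirr : IsIrreducible Q) (hQ : IsRegularGenerator Q)
    (hA : A.Nonempty) (i : {x // x ∉ A}) : ENNReal.ofReal (-Q i i) ≠ 0 := by
  obtain ⟨a, ha⟩ := hA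
  exact hirr.diag_ne_zero hQ (j := a) fun h => i.2 (h ▸ ha)

theorem nnRowSum_ABhat (a : {x // x ∈ A}) :
    nnRowSum (ABhat Q A) a = ∑' k : {x // x ∉ A}, offDiag Q a k * nnRowSum (hatQ Q A) k := by
  simp_rw [nnRowSum, ABhat, nnMul, blockAB_eq_offDiag]
  rw [ENNReal.tsum_comm]
  simp_rw [ENNReal.tsum_mul_left]

theorem ABhatBA_eq (a b : {x // x ∈ A}) :
    ABhatBA Q A a b = ∑' k : {x // x ∉ A}, offDiag Q a k * hatBA Q A k b := by
  simp_rw [ABhatBA, ABhat, hatBA, nnMul, ← ENNReal.tsum_mul_right, ← ENNReal.tsum_mul_left]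
  rw [ENNReal.tsum_comm]
  simp_rw [blockAB_eq_offDiag, mul_assoc]

variable [Countable E]

theorem hatQ_eq_green (hQ : IsRegularGenerator Q) (i j : {x // x ∉ A}) :
    hatQ Q A i j = green (fun i : {x // x ∉ A} => (ENNReal.ofReal (-Q i i))⁻¹)
      (offDiag (Q.toBlock (· ∉ A) (· ∉ A))) i j :=
  lintegral_minTransition (M := Q.toBlock (· ∉ A) (· ∉ A)) (fun i => hQ.diag_nonpos i) i j

/-- `-Q_BB (Q̂_BB c) = c` for a nonnegative vector `c`. -/
theorem tsum_hatQ_mul (hQ : IsRegularGenerator Q) (hirr : IsIrreducible Q) (hA : A.Nonempty)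
    (c : {x // x ∉ A} → ℝ≥0∞) (i : {x // x ∉ A}) :
    ENNReal.ofReal (-Q i i) * ∑' j, hatQ Q A i j * c j =
      c i + ∑' k : {x // x ∉ A}, offDiag Q i k * ∑' j, hatQ Q A k j * c j := by
  simp_rw [hatQ_eq_green hQ]
  conv_lhs => rw [tsum_green_mul, ← mul_assoc, ENNReal.mul_inv_cancel
    (hirr.diag_ne_zero_of_notMem hQ hA i) ENNReal.ofReal_ne_top, one_mul]
  simp_rw [offDiag_toBlock]

/-- An invariant measure of a recurrent chain is recovered from its restriction to `A`:
`π_B = π_A Q_AB Q̂_BB`. -/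
theorem Stationary.eq_sum_ABhat (hQ : IsRegularGenerator Q) (hirr : IsIrreducible Q)
    (hrec : ∀ i, (∫⁻ t in Set.Ioi (0 : ℝ), minTransition Q t i i) = ∞) (hA : A.Nonempty)
    {p : E → ℝ≥0∞} (hp : Stationary Q p) (hfin : ∀ i, p i ≠ ∞) (j : {x // x ∉ A}) :
    p j = ∑ a : {x // x ∈ A}, p a * ABhat Q A a j := by
  set r : {x // x ∉ A} → ℝ≥0∞ := fun k => ∑ a : {x // x ∈ A}, p a * offDiag Q a k with hr
  set y : {x // x ∉ A} → ℝ≥0∞ := fun j => ∑ a : {x // x ∈ A}, p a * ABhat Q A a j with hy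
  have hyr : ∀ j, y j = ∑' k, r k * green (fun i : {x // x ∉ A} => (ENNReal.ofReal (-Q i i))⁻¹)
      (offDiag (Q.toBlock (· ∉ A) (· ∉ A))) k j := by
    intro j
    simp_rw [hy, hr, ABhat, nnMul, Finset.sum_mul, hatQ_eq_green hQ, blockAB_eq_offDiag]
    rw [Summable.tsum_finsetSum fun _ _ => ENNReal.summable]
    simp_rw [← ENNReal.tsum_mul_left, mul_assoc]
  set x : E → ℝ≥0∞ := fun j => if h : j ∈ A then p j else y ⟨j, h⟩ with hx
  have hxA : ∀ a : {x // x ∈ A}, x a = p a := fun a => dif_pos a.2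
  have hxB : ∀ k : {x // x ∉ A}, x k = y k := fun k => dif_neg k.2
  -- Restricted to `B`, `p` solves the forward equation with source `p_A Q_AB`, of which `y` is the
  -- minimal solution.
  have hyp : ∀ j, y j ≤ p j := by
    intro j
    rw [hyr]
    refine tsum_mul_green_le (x := fun k : {x // x ∉ A} => p k) (fun j => ?_) j
    simp_rw [offDiag_toBlock, hr]
    rw [← tsum_blocks A fun k => p k * offDiag Q k j, hp, mul_assoc]
    exact mul_le_of_le_one_right' (ENNReal.mul_inv_le_one _)
  have hxp : ∀ j, x j ≤ p j := by
    intro j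
    by_cases h : j ∈ A
    · exact (hxA ⟨j, h⟩).le
    · exact (hxB ⟨j, h⟩).trans_le (hyp ⟨j, h⟩)
  -- On `A` the outflow is that of `p` and the inflow is no larger; on `B` the forward equation of
  -- the Green kernel gives exact balance.
  have hxst : Stationary Q x := by
    refine stationary_of_excessive hQ hrec
      (fun i => ne_top_of_le_ne_top (hfin i) (hxp i)) fun j => ?_
    by_cases h : j ∈ A
    · rw [hxA ⟨j, h⟩, ← hp]
      exact ENNReal.tsum_le_tsum fun k => by gcongr; exact hxp k
    · obtain ⟨j, rfl⟩ : ∃ k : {x // x ∉ A}, (k : E) = j := ⟨⟨j, h⟩, rfl⟩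
      rw [tsum_blocks A, hxB j]
      simp_rw [hxA, hxB]
      have := tsum_mul_green (D := fun i : {x // x ∉ A} => (ENNReal.ofReal (-Q i i))⁻¹)
        (N := offDiag (Q.toBlock (· ∉ A) (· ∉ A))) r j
      simp_rw [← hyr, offDiag_toBlock] at this
      rw [this, mul_assoc, ENNReal.inv_mul_cancel
        (hirr.diag_ne_zero_of_notMem hQ hA j) ENNReal.ofReal_ne_top, mul_one]
  obtain ⟨a, ha⟩ := hA
  rw [← hxst.eq_of_le hirr hp hfin hxp (hxA ⟨a, ha⟩), hxB]

/-- By the identity for `p_B`, `p a` times this row sum is at most the mass of `B`, and `p a > 0`.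
-/
theorem nnRowSum_ABhat_ne_top (hQ : IsRegularGenerator Q) (hirr : IsIrreducible Q)
    (hrec : ∀ i, (∫⁻ t in Set.Ioi (0 : ℝ), minTransition Q t i i) = ∞) (hA : A.Nonempty)
    {p : E → ℝ≥0∞} (hp : Stationary Q p) (hsum : ∑' i, p i ≠ ∞) (h0 : ∃ i, p i ≠ 0)
    (a : {x // x ∈ A}) : nnRowSum (ABhat Q A) a ≠ ∞ := by
  have hfin := ENNReal.ne_top_of_tsum_ne_top hsum
  have h1 : p a * nnRowSum (ABhat Q A) a ≤ ∑' i, p i := by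
    rw [tsum_blocks A]
    refine le_trans ?_ le_add_self
    rw [nnRowSum, ← ENNReal.tsum_mul_left]
    refine ENNReal.tsum_le_tsum fun j => ?_
    rw [hp.eq_sum_ABhat hQ hirr hrec hA hfin j]
    exact Finset.single_le_sum (f := fun a : {x // x ∈ A} => p a * ABhat Q A a j)
      (fun _ _ => zero_le) (Finset.mem_univ a)
  intro h
  rw [h, ENNReal.mul_top (hp.ne_zero hirr h0 a)] at h1
  exact hsum (top_le_iff.1 h1)

/-- Finiteness spreads along jumps: a finite row sum at `i` in `B`, or of `Q_AB Q̂_BB` at `i` in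
`A`, bounds a series containing each successor's row sum with positive weight. States of `A` lie in
the closed set vacuously and start the argument. -/
theorem nnRowSum_hatQ_ne_top (hQ : IsRegularGenerator Q) (hirr : IsIrreducible Q)
    (hA : A.Nonempty) (hAB : ∀ a, nnRowSum (ABhat Q A) a ≠ ∞) (i : {x // x ∉ A}) :
    nnRowSum (hatQ Q A) i ≠ ∞ := by
  refine hirr.mem_of_closed (S := {k | ∀ h : k ∉ A, nnRowSum (hatQ Q A) ⟨k, h⟩ ≠ ∞})
    (fun i hi k hk hkA => ?_) ⟨hA.choose, fun h => absurd hA.choose_spec h⟩ i i.2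
  have key : ∑' k : {x // x ∉ A}, offDiag Q i k * nnRowSum (hatQ Q A) k ≠ ∞ := by
    by_cases hiA : i ∈ A
    · rw [← nnRowSum_ABhat ⟨i, hiA⟩]
      exact hAB _
    · have h := tsum_hatQ_mul hQ hirr hA (fun _ => 1) ⟨i, hiA⟩
      simp only [mul_one] at h
      refine ne_top_of_le_ne_top ?_ (le_add_self.trans h.ge)
      exact ENNReal.mul_ne_top ENNReal.ofReal_ne_top (hi hiA)
  exact fun h => ENNReal.ne_top_of_tsum_ne_top key ⟨k, hkA⟩ (by simp [h, ENNReal.mul_top hk])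

/-- The constant `1` is a supersolution of the equation for hitting `A`, because the rows of `Q` sum
to `0`. -/
theorem nnRowSum_hatBA_le (hQ : IsRegularGenerator Q) (i : {x // x ∉ A}) :
    ∑ a, hatBA Q A i a ≤ 1 := by
  simp_rw [hatBA, nnMul]
  rw [← Summable.tsum_finsetSum fun _ _ => ENNReal.summable]
  simp_rw [← Finset.mul_sum, hatQ_eq_green hQ]
  refine tsum_green_mul_le (x := fun _ => 1) (fun i => ?_) i
  simp_rw [offDiag_toBlock, mul_one, blockBA_eq_offDiag]
  rw [← tsum_blocks A (offDiag Q i), hQ.tsum_offDiag, mul_comm]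
  exact ENNReal.mul_inv_le_one _

/-- The row sums of the censored generator are nonpositive. -/
theorem sum_ABhatBA_le (hQ : IsRegularGenerator Q) (a : {x // x ∈ A}) :
    ∑ b : {x // x ∈ A}, (offDiag Q a b + ABhatBA Q A a b) ≤ ENNReal.ofReal (-Q a a) := by
  rw [Finset.sum_add_distrib, ← hQ.tsum_offDiag, tsum_blocks A]
  gcongr
  simp_rw [ABhatBA_eq]
  rw [← Summable.tsum_finsetSum fun _ _ => ENNReal.summable]
  simp_rw [← Finset.mul_sum]
  exact ENNReal.tsum_le_tsum fun k => mul_le_of_le_one_right' (nnRowSum_hatBA_le hQ k)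

theorem wellDefined_of_nnRowSum (hQ : IsRegularGenerator Q)
    (hAB : ∀ a, nnRowSum (ABhat Q A) a ≠ ∞) (hB : ∀ i, nnRowSum (hatQ Q A) i ≠ ∞) :
    WellDefined Q A where
  hatQ_finite i := ENNReal.ne_top_of_tsum_ne_top (hB i)
  hatQ_row_finite := hB
  ABhat_finite a := ENNReal.ne_top_of_tsum_ne_top (hAB a)
  ABhat_row_finite := hAB
  hatBA_finite i a := ne_top_of_le_ne_top ENNReal.one_ne_top
    ((Finset.single_le_sum (fun _ _ => zero_le) (Finset.mem_univ a)).trans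
      (nnRowSum_hatBA_le hQ i))
  ABhatBA_finite a b := ne_top_of_le_ne_top ENNReal.ofReal_ne_top
    ((le_add_self.trans (Finset.single_le_sum
      (f := fun b : {x // x ∈ A} => offDiag Q a b + ABhatBA Q A a b)
      (fun _ _ => zero_le) (Finset.mem_univ b))).trans (sum_ABhatBA_le hQ a))

end Censoring
-- Group inverses of finite matrices with a rank-one null projection.
section GroupInverse

variable {m : Type*} [Fintype m]

open Matrix in
/-- A matrix with right null vector `e` and left null vector `ν`, `ν e = 1`, that is injective on
the kernel of `ν` has a group inverse `V`, with `W V = I - e ν`. -/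
theorem exists_isGroupInverse [DecidableEq m] {W : Matrix m m ℝ} {ν : m → ℝ} (hν : ν ⬝ᵥ 1 = 1)
    (hW : W *ᵥ 1 = 0) (hνW : ν ᵥ* W = 0) (hker : ∀ v, W *ᵥ v = 0 → ν ⬝ᵥ v = 0 → v = 0) :
    ∃ V, IsGroupInverse W V ∧ W * V = 1 - vecMulVec 1 ν := by
  set P : Matrix m m ℝ := vecMulVec 1 ν with hP
  have hWP : W * P = 0 := by rw [hP, mul_vecMulVec, hW]; ext; simp [vecMulVec]
  have hPW : P * W = 0 := by rw [hP, vecMulVec_mul, hνW]; ext; simp [vecMulVec]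
  have hPP : P * P = P := by
    rw [hP, mul_vecMulVec, vecMulVec_mulVec, hν]; ext; simp [vecMulVec]
  -- If `(W + P) v = 0`, applying `P` gives `P v = 0`, hence `W v = 0` and `ν v = 0`, so `v = 0`.
  have hdet : IsUnit (W + P).det := by
    rw [isUnit_iff_ne_zero]
    intro h
    obtain ⟨v, hv0, hv⟩ := exists_mulVec_eq_zero_iff.2 h
    have h1 : P *ᵥ v = 0 := by
      have : P * (W + P) = P := by rw [mul_add, hPW, hPP, zero_add]
      rw [← this, ← mulVec_mulVec, hv, mulVec_zero]
    have h2 : W *ᵥ v = 0 := by rw [add_mulVec, h1, add_zero] at hv; exact hv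
    refine hv0 (hker v h2 ?_)
    by_contra hne
    rw [hP, vecMulVec_mulVec] at h1
    rcases isEmpty_or_nonempty m with hm | ⟨⟨i⟩⟩
    · simp at hν
    · have := congrFun h1 i
      simp at this
      exact hne this
  -- The fundamental matrix: `Z` fixes `P` on both sides, so `Z - P` inverts `W` on the complement
  -- of the null space.
  set Z := (W + P)⁻¹ with hZ
  have hZl : Z * (W + P) = 1 := nonsing_inv_mul _ hdet
  have hZr : (W + P) * Z = 1 := mul_nonsing_inv _ hdet
  have hZP : Z * P = P := by
    have : (W + P) * P = P := by rw [add_mul, hWP, hPP, zero_add]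
    rw [← this, ← Matrix.mul_assoc, hZl, Matrix.one_mul, this]
  have hPZ : P * Z = P := by
    have : P * (W + P) = P := by rw [mul_add, hPW, hPP, zero_add]
    rw [← this, Matrix.mul_assoc, hZr, Matrix.mul_one, this]
  have hWV : W * (Z - P) = 1 - P := by
    rw [mul_sub, hWP, sub_zero, ← hZr, add_mul, hPZ, add_sub_cancel_right]
  have hVW : (Z - P) * W = 1 - P := by
    rw [sub_mul, hPW, sub_zero, ← hZl, mul_add, hZP, add_sub_cancel_right]
  refine ⟨Z - P, ⟨?_, ?_, hVW.trans hWV.symm⟩, hWV⟩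
  · rw [hWV, sub_mul, hPW, Matrix.one_mul, sub_zero]
  · rw [hVW, sub_mul, Matrix.one_mul, mul_sub, hPZ, hPP, sub_self, sub_zero]

theorem IsGroupInverse.groupInverse_eq {W V : Matrix m m ℝ} (h : IsGroupInverse W V) :
    groupInverse W = V := by
  have hex : ∃ V, IsGroupInverse W V := ⟨V, h⟩
  rw [groupInverse, dif_pos hex]
  exact hex.choose_spec.unique h

end GroupInverse

/-! ### Null vectors of the censored generator. -/

section Poisson

variable {E : Type*} [DecidableEq E] {Q : Matrix E E ℝ} {A : Finset E}

/-- Isolates the nonnegative jump rates. The diagonal keeps an `ABhatBA` term, from excursions into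
`B` that return to their starting state. -/
theorem censored_apply (hQ : IsRegularGenerator Q) (hwd : WellDefined Q A) (a b : {x // x ∈ A}) :
    censored Q A a b =
      (offDiag Q a b + ABhatBA Q A a b).toReal + if a = b then Q a a else 0 := by
  rw [ENNReal.toReal_add (offDiag_ne_top Q a b) (hwd.ABhatBA_finite a b)]
  simp only [censored, Matrix.add_apply, Matrix.toBlock_apply, Matrix.map_apply]
  by_cases h : a = b
  · subst h; simp [offDiag]; ring
  · have h' : (b : E) ≠ a := fun e => h (Subtype.ext e.symm)
    simp [h, offDiag_ne Q h', ENNReal.toReal_ofReal (hQ.offDiag_nonneg a b h'.symm)]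

/-- Eliminating `p_B` from the balance equations at states of `A` leaves `p_A Q^(A) = 0`. -/
theorem Stationary.sum_mul_censored (hQ : IsRegularGenerator Q) (hwd : WellDefined Q A)
    {p : E → ℝ≥0∞} (hp : Stationary Q p) (hfin : ∀ i, p i ≠ ∞)
    (hpB : ∀ j : {x // x ∉ A}, p j = ∑ a : {x // x ∈ A}, p a * ABhat Q A a j)
    (b : {x // x ∈ A}) : ∑ a : {x // x ∈ A}, (p a).toReal * censored Q A a b = 0 := by
  have h := hp b
  rw [tsum_blocks A] at h
  simp_rw [hpB, Finset.sum_mul] at h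
  rw [Summable.tsum_finsetSum fun _ _ => ENNReal.summable] at h
  simp_rw [mul_assoc, ENNReal.tsum_mul_left, ← blockBA_eq_offDiag] at h
  change _ + ∑ a : {x // x ∈ A}, p a * ABhatBA Q A a b = _ at h
  rw [← Finset.sum_add_distrib] at h
  simp_rw [← mul_add] at h
  have h' := congrArg ENNReal.toReal h
  rw [ENNReal.toReal_sum fun (a : {x // x ∈ A}) _ => ENNReal.mul_ne_top (hfin a) (ENNReal.add_ne_top.2
    ⟨offDiag_ne_top Q a b, hwd.ABhatBA_finite a b⟩)] at h'
  simp_rw [ENNReal.toReal_mul] at h'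
  rw [ENNReal.toReal_ofReal (by linarith [hQ.diag_nonpos b])] at h'
  simp_rw [censored_apply hQ hwd, mul_add, Finset.sum_add_distrib, h']
  simp

variable [Countable E]

theorem sum_censored_nonpos (hQ : IsRegularGenerator Q) (hwd : WellDefined Q A)
    (a : {x // x ∈ A}) : ∑ b, censored Q A a b ≤ 0 := by
  simp_rw [censored_apply hQ hwd, Finset.sum_add_distrib]
  have h := ENNReal.toReal_mono ENNReal.ofReal_ne_top (sum_ABhatBA_le hQ a)
  rw [ENNReal.toReal_sum fun (b : {x // x ∈ A}) _ => ENNReal.add_ne_top.2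
    ⟨offDiag_ne_top Q a b, hwd.ABhatBA_finite a b⟩,
    ENNReal.toReal_ofReal (by linarith [hQ.diag_nonpos a])] at h
  simp only [Finset.sum_ite_eq, Finset.mem_univ, if_true]
  linarith

theorem diag_mul_hatBA (hQ : IsRegularGenerator Q) (hirr : IsIrreducible Q)
    (hA : A.Nonempty) (i : {x // x ∉ A}) (b : {x // x ∈ A}) :
    ENNReal.ofReal (-Q i i) * hatBA Q A i b =
      offDiag Q i b + ∑' k : {x // x ∉ A}, offDiag Q i k * hatBA Q A k b := by
  rw [← blockBA_eq_offDiag]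
  exact tsum_hatQ_mul hQ hirr hA (fun j => blockBA Q A j b) i

/-- Vectors annihilated by a conservative censored generator are constant. -/
theorem eq_const_of_censored_mulVec (hQ : IsRegularGenerator Q) (hirr : IsIrreducible Q)
    (hA : A.Nonempty) (hwd : WellDefined Q A) (hrow : ∀ a, ∑ b, censored Q A a b = 0)
    {v : {x // x ∈ A} → ℝ} (hv : ∀ a, ∑ b, censored Q A a b * v b = 0) :
    ∃ c, ∀ a, v a = c := by
  have : Nonempty {x // x ∈ A} := ⟨⟨_, hA.choose_spec⟩⟩
  obtain ⟨a₀, ha₀⟩ := Finite.exists_max v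
  refine ⟨v a₀, ?_⟩
  -- Maximum principle: at a maximizer, nonnegative rates times nonnegative gaps sum to `0`; the
  -- negative diagonal entry meets a zero gap.
  have hmax : ∀ a, v a = v a₀ → ∀ b : {x // x ∈ A}, offDiag Q a b + ABhatBA Q A a b ≠ 0 → v b = v a₀ := by
    intro a ha b hb
    have h0 : ∑ b : {x // x ∈ A}, (offDiag Q a b + ABhatBA Q A a b).toReal * (v a₀ - v b) = 0 := by
      have h1 : ∑ b, censored Q A a b * (v a₀ - v b) = 0 := by
        simp_rw [mul_sub, Finset.sum_sub_distrib, ← Finset.sum_mul, hrow, hv]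
        simp
      rw [← h1]
      refine Finset.sum_congr rfl fun b _ => ?_
      rw [censored_apply hQ hwd]
      by_cases h : a = b
      · subst h; simp [ha]
      · simp [h]
    have h2 := (Finset.sum_eq_zero_iff_of_nonneg fun b _ =>
      mul_nonneg ENNReal.toReal_nonneg (sub_nonneg.2 (ha₀ b))).1 h0 b (Finset.mem_univ b)
    rcases mul_eq_zero.1 h2 with h3 | h3
    · rcases (ENNReal.toReal_eq_zero_iff _).1 h3 with h4 | h4
      · exact absurd h4 hb
      · exact absurd h4 (ENNReal.add_ne_top.2 ⟨offDiag_ne_top Q a b, hwd.ABhatBA_finite a b⟩)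
    · linarith
  -- Extends maximality to `B`: a state of `B` qualifies if `v` is maximal at every state through
  -- which it may enter `A`. This set is closed under jumps of the full chain, so irreducibility of
  -- `Q` suffices.
  let S : Set E := {i | (∀ h : i ∈ A, v ⟨i, h⟩ = v a₀) ∧
    ∀ h : i ∉ A, ∀ b, hatBA Q A ⟨i, h⟩ b ≠ 0 → v b = v a₀}
  have hS : ∀ i, i ∈ S := by
    refine hirr.mem_of_closed (fun i hi k hk => ⟨fun hkA => ?_, fun hkA b hb => ?_⟩)
      ⟨a₀, fun _ => rfl, fun h => absurd a₀.2 h⟩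
    · by_cases hiA : i ∈ A
      · exact hmax ⟨i, hiA⟩ (hi.1 hiA) ⟨k, hkA⟩ fun h => hk (add_eq_zero.1 h).1
      · refine hi.2 hiA ⟨k, hkA⟩ fun h => hk ?_
        have := diag_mul_hatBA hQ hirr hA ⟨i, hiA⟩ ⟨k, hkA⟩
        rw [h, mul_zero] at this
        exact (add_eq_zero.1 this.symm).1
    · have hkb : ∀ x, x = ∑' k : {x // x ∉ A}, offDiag Q i k * hatBA Q A k b → x ≠ 0 := by
        rintro x rfl h
        exact mul_ne_zero hk hb (ENNReal.tsum_eq_zero.1 h ⟨k, hkA⟩)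
      by_cases hiA : i ∈ A
      · exact hmax ⟨i, hiA⟩ (hi.1 hiA) b fun h =>
          hkb _ (ABhatBA_eq ⟨i, hiA⟩ b) (add_eq_zero.1 h).2
      · refine hi.2 hiA b fun h => hkb _ rfl ?_
        have := diag_mul_hatBA hQ hirr hA ⟨i, hiA⟩ b
        rw [h, mul_zero] at this
        exact (add_eq_zero.1 this.symm).2
  exact fun a => (hS a).1 a.2

open Matrix in
theorem exists_isGroupInverse_censored (hQ : IsRegularGenerator Q) (hirr : IsIrreducible Q)
    (hA : A.Nonempty) (hwd : WellDefined Q A) {w : {x // x ∈ A} → ℝ} (hw : ∀ a, 0 < w a)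
    (hst : ∀ b, ∑ a, w a * censored Q A a b = 0) :
    IsGroupInverse (-censored Q A) (groupInverse (-censored Q A)) ∧
      ∀ {n : Type _} (R : Matrix {x // x ∈ A} n ℝ), (∀ j, ∑ a, w a * R a j = 0) →
        -censored Q A * (groupInverse (-censored Q A) * R) = R := by
  -- The row sums are nonpositive and their combination with the positive weights `w` vanishes, so
  -- each is `0`.
  have hrow : ∀ a, ∑ b, censored Q A a b = 0 := by
    have h0 : ∑ a, w a * -∑ b, censored Q A a b = 0 := by
      simp_rw [mul_neg, Finset.sum_neg_distrib, Finset.mul_sum]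
      rw [Finset.sum_comm]
      simp [hst, -Finset.univ_eq_attach]
    intro a
    have h1 := (Finset.sum_eq_zero_iff_of_nonneg fun b _ => mul_nonneg (hw b).le
      (neg_nonneg.2 (sum_censored_nonpos hQ hwd b))).1 h0 a (Finset.mem_univ a)
    have := (mul_eq_zero.1 h1).resolve_left (hw a).ne'
    linarith
  have : Nonempty {x // x ∈ A} := ⟨⟨_, hA.choose_spec⟩⟩
  set s := ∑ a, w a with hs
  have hs0 : 0 < s := Finset.sum_pos (fun a _ => hw a) Finset.univ_nonempty
  obtain ⟨V, hV, hWV⟩ := exists_isGroupInverse (W := -censored Q A) (ν := s⁻¹ • w)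
    (by rw [smul_dotProduct, dotProduct_one, smul_eq_mul, inv_mul_cancel₀ hs0.ne'])
    (by ext a; simp [mulVec, dotProduct, hrow, -Finset.univ_eq_attach])
    (by
      rw [smul_vecMul]
      ext b
      simp [vecMul, dotProduct, hst, -Finset.univ_eq_attach])
    (by
      intro v hv hνv
      obtain ⟨c, hc⟩ := eq_const_of_censored_mulVec hQ hirr hA hwd hrow (v := v) fun a => by
        have := congrFun hv a
        simpa [mulVec, dotProduct] using this
      have : v = fun _ => c := funext hc
      subst this
      rw [smul_dotProduct, dotProduct, ← Finset.sum_mul, ← hs, smul_eq_mul] at hνv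
      have : c = 0 := by
        rcases mul_eq_zero.1 hνv with h | h
        · exact absurd h (inv_ne_zero hs0.ne')
        · exact (mul_eq_zero.1 h).resolve_left hs0.ne'
      ext; simp [this])
  rw [hV.groupInverse_eq]
  refine ⟨hV, fun R hR => ?_⟩
  rw [← Matrix.mul_assoc, hWV, Matrix.sub_mul, Matrix.one_mul, vecMulVec_mul]
  have : (s⁻¹ • w) ᵥ* R = 0 := by
    rw [smul_vecMul]
    ext j
    simp [vecMul, dotProduct, hR, -Finset.univ_eq_attach]
  rw [this]
  ext; simp [vecMulVec]

end Poisson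
-- Verification of Poisson's equation row by row.
section Solution

variable {E : Type*} [DecidableEq E] {Q : Matrix E E ℝ} {A : Finset E}

theorem hasSum_offDiag_toReal {i : E} {y : {x // x ∉ A} → ℝ≥0∞}
    (hy : ∑' k : {x // x ∉ A}, offDiag Q i k * y k ≠ ∞) :
    HasSum (fun k : {x // x ∉ A} => (offDiag Q i k).toReal * (y k).toReal)
      (∑' k : {x // x ∉ A}, offDiag Q i k * y k).toReal := by
  rw [ENNReal.tsum_toReal_eq (ENNReal.ne_top_of_tsum_ne_top hy)]
  simpa only [ENNReal.toReal_mul] using ENNReal.hasSum_toReal hy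

theorem hasSum_row_of_mem (hQ : IsRegularGenerator Q) (i : {x // x ∈ A})
    {y : {x // x ∉ A} → ℝ≥0∞} (hy : ∑' k : {x // x ∉ A}, offDiag Q i k * y k ≠ ∞) :
    HasSum (fun k : {x // x ∉ A} => Q i k * (y k).toReal)
      (∑' k : {x // x ∉ A}, offDiag Q i k * y k).toReal := by
  refine (hasSum_offDiag_toReal hy).congr_fun fun k => ?_
  have h : (k : E) ≠ i := fun h => k.2 (h ▸ i.2)
  rw [offDiag_ne Q h, ENNReal.toReal_ofReal (hQ.offDiag_nonneg i k h.symm)]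

theorem hasSum_row_of_notMem [Countable E] (hQ : IsRegularGenerator Q) (hirr : IsIrreducible Q)
    (hA : A.Nonempty) (i : {x // x ∉ A}) (c : {x // x ∉ A} → ℝ≥0∞)
    (hfin : ∑' j, hatQ Q A i j * c j ≠ ∞) :
    HasSum (fun k : {x // x ∉ A} => Q i k * (∑' j, hatQ Q A k j * c j).toReal)
      (-(c i).toReal) := by
  have h := tsum_hatQ_mul hQ hirr hA c i
  have hne := ENNReal.add_ne_top.1 (h ▸ ENNReal.mul_ne_top ENNReal.ofReal_ne_top hfin)
  have h' := congrArg ENNReal.toReal h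
  rw [ENNReal.toReal_mul, ENNReal.toReal_ofReal (by linarith [hQ.diag_nonpos i]),
    ENNReal.toReal_add hne.1 hne.2] at h'
  -- `offDiag` vanishes at `k = i`, so the diagonal term is restored as a one-point series.
  have hs := (hasSum_offDiag_toReal hne.2).add
    (hasSum_ite_eq i (Q i i * (∑' j, hatQ Q A i j * c j).toReal))
  convert hs using 1
  · ext k
    by_cases hk : k = i
    · subst hk; simp [offDiag]
    · have hk' : (k : E) ≠ i := fun e => hk (Subtype.ext e)
      rw [offDiag_ne Q hk', ENNReal.toReal_ofReal (hQ.offDiag_nonneg i k hk'.symm), if_neg hk,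
        add_zero]
  · linarith

theorem hatQ_mul_single (k j : {x // x ∉ A}) :
    ∑' l, hatQ Q A k l * (if l = j then 1 else 0) = hatQ Q A k j := by
  simp

theorem ABhat_eq (a : {x // x ∈ A}) (j : {x // x ∉ A}) :
    ABhat Q A a j = ∑' k : {x // x ∉ A}, offDiag Q a k * hatQ Q A k j := by
  simp_rw [ABhat, nnMul, blockAB_eq_offDiag]

theorem sol_of_mem (π : E → ℝ) (a : {x // x ∈ A}) (n : E) : sol Q A π a n = solA Q A π a n :=
  dif_pos a.2

theorem sol_of_notMem (π : E → ℝ) (k : {x // x ∉ A}) (n : E) :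
    sol Q A π k n = (∑ a, (hatBA Q A k a).toReal * solA Q A π a n) +
      (if hn : n ∈ A then 0 else (hatQ Q A k ⟨n, hn⟩).toReal) -
      (nnRowSum (hatQ Q A) k).toReal * π n :=
  dif_neg k.2

/-- The rows of `Q X` from the sums of the rows of `Q_{iB}` against the columns of `Q̂_BB Q_BA`,
`Q̂_BB` and `Q̂_BB e`. -/
theorem hasSum_row_mul_sol (π : E → ℝ) (i j : E) {u : {x // x ∈ A} → ℝ} {v : {x // x ∉ A} → ℝ}
    {w : ℝ}
    (hu : ∀ a, HasSum (fun k : {x // x ∉ A} => Q i k * (hatBA Q A k a).toReal) (u a))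
    (hv : ∀ l, HasSum (fun k : {x // x ∉ A} => Q i k * (hatQ Q A k l).toReal) (v l))
    (hw : HasSum (fun k : {x // x ∉ A} => Q i k * (nnRowSum (hatQ Q A) k).toReal) w) :
    HasSum (fun k => -Q i k * sol Q A π k j)
      (-(∑ a : {x // x ∈ A}, (Q i a + u a) * solA Q A π a j +
        (if hn : j ∈ A then 0 else v ⟨j, hn⟩) - w * π j)) := by
  have h1 : HasSum (fun k : {x // x ∉ A} => Q i k * sol Q A π k j)
      (∑ a, u a * solA Q A π a j + (if hn : j ∈ A then 0 else v ⟨j, hn⟩) - w * π j) := by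
    have hv' : HasSum (fun k : {x // x ∉ A} => Q i k *
        (if hn : j ∈ A then 0 else (hatQ Q A k ⟨j, hn⟩).toReal))
        (if hn : j ∈ A then 0 else v ⟨j, hn⟩) := by
      split_ifs with hn
      · simp
      · exact hv _
    refine (((hasSum_sum fun a _ => (hu a).mul_right (solA Q A π a j)).add hv').sub
      (hw.mul_right (π j))).congr_fun fun k => ?_
    rw [sol_of_notMem, mul_sub, mul_add, Finset.mul_sum]
    simp only [mul_assoc]
  have h2 := (hasSum_of_blocks (f := fun k => Q i k * sol Q A π k j) h1).neg
  have h3 : HasSum (fun k => -Q i k * sol Q A π k j) _ := h2.congr_fun fun k => neg_mul _ _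
  convert h3 using 1
  simp_rw [sol_of_mem, add_mul, Finset.sum_add_distrib]
  ring

/-- Solvability condition: `π_A [I, Q_AB Q̂_BB] = πᵀ`, and `π_A (e + Q_AB Q̂_BB e)` is the total
mass `1`, so the two terms cancel. -/
theorem sum_mul_rhsA {π : E → ℝ} (hπ : IsInvariantProb Q π) (hwd : WellDefined Q A)
    (hpB : ∀ j : {x // x ∉ A}, ENNReal.ofReal (π j) =
      ∑ a : {x // x ∈ A}, ENNReal.ofReal (π a) * ABhat Q A a j) (n : E) :
    ∑ a : {x // x ∈ A}, π a * rhsA Q A π a n = 0 := by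
  have htot : ∑ a : {x // x ∈ A}, π a * (1 + (nnRowSum (ABhat Q A) a).toReal) = 1 := by
    have h1 : ∑' i, ENNReal.ofReal (π i) = 1 := by
      rw [← ENNReal.ofReal_tsum_of_nonneg hπ.nonneg hπ.sum_one.summable, hπ.sum_one.tsum_eq,
        ENNReal.ofReal_one]
    rw [tsum_blocks A] at h1
    simp_rw [hpB] at h1
    rw [Summable.tsum_finsetSum fun _ _ => ENNReal.summable, ← Finset.sum_add_distrib] at h1
    simp_rw [ENNReal.tsum_mul_left, ← nnRowSum.eq_1] at h1
    have h2 := congrArg ENNReal.toReal h1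
    rw [ENNReal.toReal_sum fun (a : {x // x ∈ A}) _ => ENNReal.add_ne_top.2
      ⟨ENNReal.ofReal_ne_top, ENNReal.mul_ne_top ENNReal.ofReal_ne_top
        (hwd.ABhat_row_finite a)⟩, ENNReal.toReal_one] at h2
    refine Eq.trans ?_ h2
    refine Finset.sum_congr rfl fun a _ => ?_
    rw [ENNReal.toReal_add ENNReal.ofReal_ne_top (ENNReal.mul_ne_top ENNReal.ofReal_ne_top
      (hwd.ABhat_row_finite a)), ENNReal.toReal_mul, ENNReal.toReal_ofReal (hπ.nonneg a)]
    ring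
  simp_rw [rhsA, mul_sub, Finset.sum_sub_distrib, ← mul_assoc, ← Finset.sum_mul, htot, one_mul]
  rw [sub_eq_zero]
  by_cases hn : n ∈ A
  · simp [hn, Matrix.one_apply, -Finset.univ_eq_attach]
  · have h := congrArg ENNReal.toReal (hpB ⟨n, hn⟩)
    rw [ENNReal.toReal_sum fun (a : {x // x ∈ A}) _ => ENNReal.mul_ne_top ENNReal.ofReal_ne_top
      (hwd.ABhat_finite a _), ENNReal.toReal_ofReal (hπ.nonneg n)] at h
    simp only [hn, dite_false]
    rw [h]
    refine Finset.sum_congr rfl fun a _ => ?_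
    rw [ENNReal.toReal_mul, ENNReal.toReal_ofReal (hπ.nonneg a)]

/-- After substituting `X_B`, the coefficients of `X_A` collect into `Q^(A)`, and the remaining
terms are those of `rhsA`. -/
theorem hasSum_poisson_of_mem (hQ : IsRegularGenerator Q) (hwd : WellDefined Q A) (π : E → ℝ)
    (hsol : -censored Q A * solA Q A π = rhsA Q A π) (i : {x // x ∈ A}) (j : E) :
    HasSum (fun k => -Q i k * sol Q A π k j) ((1 : Matrix E E ℝ) i j - π j) := by
  have hu : ∀ a, HasSum (fun k : {x // x ∉ A} => Q i k * (hatBA Q A k a).toReal)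
      (ABhatBA Q A i a).toReal := fun a => by
    rw [ABhatBA_eq]
    exact hasSum_row_of_mem hQ i (ABhatBA_eq i a ▸ hwd.ABhatBA_finite i a)
  have hv : ∀ l, HasSum (fun k : {x // x ∉ A} => Q i k * (hatQ Q A k l).toReal)
      (ABhat Q A i l).toReal := fun l => by
    rw [ABhat_eq]
    exact hasSum_row_of_mem hQ i (ABhat_eq i l ▸ hwd.ABhat_finite i l)
  have hw : HasSum (fun k : {x // x ∉ A} => Q i k * (nnRowSum (hatQ Q A) k).toReal)
      (nnRowSum (ABhat Q A) i).toReal := by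
    rw [nnRowSum_ABhat]
    exact hasSum_row_of_mem hQ i (nnRowSum_ABhat i ▸ hwd.ABhat_row_finite i)
  convert hasSum_row_mul_sol π i j hu hv hw using 1
  have h := congrFun (congrFun hsol i) j
  rw [Matrix.neg_mul, Matrix.neg_apply, Matrix.mul_apply, rhsA] at h
  simp only [censored, Matrix.add_apply, Matrix.toBlock_apply, Matrix.map_apply] at h
  by_cases hj : j ∈ A
  · simp only [hj, dite_true, Matrix.one_apply, Subtype.ext_iff] at h ⊢
    linarith
  · have hij : (i : E) ≠ j := fun e => hj (e ▸ i.2)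
    simp only [hj, dite_false, Matrix.one_apply, hij, if_false] at h ⊢
    linarith

/-- The coefficient of `X_A` is `Q_BA + Q_BB Q̂_BB Q_BA = 0`, so the choice of `X_A` plays no role
here. -/
theorem hasSum_poisson_of_notMem [Countable E] (hQ : IsRegularGenerator Q) (hirr : IsIrreducible Q)
    (hA : A.Nonempty) (hwd : WellDefined Q A) (π : E → ℝ) (i : {x // x ∉ A}) (j : E) :
    HasSum (fun k => -Q i k * sol Q A π k j) ((1 : Matrix E E ℝ) i j - π j) := by
  have hu : ∀ a, HasSum (fun k : {x // x ∉ A} => Q i k * (hatBA Q A k a).toReal)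
      (-(Q i a)) := fun a => by
    have h := hasSum_row_of_notMem hQ hirr hA i (fun l => blockBA Q A l a) (hwd.hatBA_finite i a)
    have hia : (i : E) ≠ a := fun e => i.2 (e ▸ a.2)
    rw [blockBA_eq_offDiag, offDiag_ne Q hia.symm,
      ENNReal.toReal_ofReal (hQ.offDiag_nonneg i a hia)] at h
    exact h
  have hv : ∀ l, HasSum (fun k : {x // x ∉ A} => Q i k * (hatQ Q A k l).toReal)
      (-(if i = l then 1 else 0)) := fun l => by
    have h := hasSum_row_of_notMem hQ hirr hA i (fun k => if k = l then 1 else 0)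
      (by rw [hatQ_mul_single]; exact hwd.hatQ_finite i l)
    simp_rw [hatQ_mul_single] at h
    convert h using 1
    split_ifs <;> simp
  have hw : HasSum (fun k : {x // x ∉ A} => Q i k * (nnRowSum (hatQ Q A) k).toReal) (-1) := by
    have h := hasSum_row_of_notMem hQ hirr hA i (fun _ => 1)
      (by simpa only [mul_one, nnRowSum] using hwd.hatQ_row_finite i)
    simpa only [mul_one, ENNReal.toReal_one, nnRowSum] using h
  convert hasSum_row_mul_sol π i j hu hv hw using 1
  by_cases hj : j ∈ A
  · have hij : (i : E) ≠ j := fun e => i.2 (e ▸ hj)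
    simp [hj, hij]
  · simp [hj, Matrix.one_apply, Subtype.ext_iff]
    ring

end Solution
end CTMC

theorem theorem4 {E : Type*} [Countable E] [DecidableEq E] (Q : Matrix E E ℝ) (π : E → ℝ)
    (hQ : CTMC.IsRegularGenerator Q) (hirr : CTMC.IsIrreducible Q)
    (hpos : CTMC.IsPositiveRecurrent Q) (hπ : CTMC.IsInvariantProb Q π)
    (A : Finset E) (hA : A.Nonempty) :
    CTMC.WellDefined Q A ∧
    CTMC.IsGroupInverse (-CTMC.censored Q A) (CTMC.groupInverse (-CTMC.censored Q A)) ∧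
    ∀ i j, HasSum (fun k => -Q i k * CTMC.sol Q A π k j) ((1 : Matrix E E ℝ) i j - π j) := by
  have hrec := fun i => (hpos i).1
  have hst := hπ.stationary hQ
  have hsum : ∑' i, ENNReal.ofReal (π i) = 1 := by
    rw [← ENNReal.ofReal_tsum_of_nonneg hπ.nonneg hπ.sum_one.summable, hπ.sum_one.tsum_eq,
      ENNReal.ofReal_one]
  have hfin : ∀ i, ENNReal.ofReal (π i) ≠ ∞ := fun _ => ENNReal.ofReal_ne_top
  have hne : ∃ i, ENNReal.ofReal (π i) ≠ 0 := by
    by_contra! h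
    simp [h] at hsum
  -- This identity holds in `[0, ∞]` before any finiteness of `Q̂_BB` is known; finiteness is then
  -- deduced from it.
  have hpB := hst.eq_sum_ABhat hQ hirr hrec hA hfin
  have hAB := CTMC.nnRowSum_ABhat_ne_top hQ hirr hrec hA hst (hsum ▸ ENNReal.one_ne_top) hne
  have hwd := CTMC.wellDefined_of_nnRowSum hQ hAB (CTMC.nnRowSum_hatQ_ne_top hQ hirr hA hAB)
  have hcol : ∀ b, ∑ a : {x // x ∈ A}, π a * CTMC.censored Q A a b = 0 := fun b => by
    simpa only [ENNReal.toReal_ofReal (hπ.nonneg _)] using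
      hst.sum_mul_censored hQ hwd hfin hpB b
  obtain ⟨hinv, hsol⟩ := CTMC.exists_isGroupInverse_censored hQ hirr hA hwd
    (w := fun a => π a) (fun a => by
      have := hst.ne_zero hirr hne a
      rwa [ne_eq, ENNReal.ofReal_eq_zero, not_le] at this) hcol
  refine ⟨hwd, hinv, fun i j => ?_⟩
  by_cases hi : i ∈ A
  · exact CTMC.hasSum_poisson_of_mem hQ hwd π
      (hsol _ (CTMC.sum_mul_rhsA hπ hwd hpB)) ⟨i, hi⟩ j
  · exact CTMC.hasSum_poisson_of_notMem hQ hirr hA hwd π ⟨i, hi⟩ j
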